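/- Let $d\ge 1$, $\alpha>d$ and $\lambda>0$. Consider weighted scale-free percolation $\mathrm{SFP}_{W,L}$ on $\mathbb Z^d$: the vertices $x\in\mathbb Z^d$ carry i.i.d. vertex-weights $W_x$ distributed as a random variable $W$ with $\mathbb P(W\ge 1)=1$; given all vertex-weights, the edges are present independently of each other, the edge between $x$ and $y$ being present with probability $1$ if $\|x-y\|=1$ and with probability $1-\exp\{-\lambda W_xW_y/\|x-y\|^{\alpha}\}$ if $\|x-y\|>1$, where $\|\cdot\|$ is the Euclidean norm; and, independently of the vertex-weights and of the graph, the edges $e$ carry i.i.d. real edge-weights $L_e$ with distribution function $F_L$. For $x,y\in\mathbb Z^d$ let $\mathrm d_G(x,y)$ be the smallest number of edges, and $\mathrm d_L(x,y)$ the infimum of $\sum_{e\in\pi}L_e$, over all paths $\pi$ from $x$ to $y$. Let $B^2_r(x)$, $B^G_r(x)$, $B^L_r(x)$ be the sets of all $y\in\mathbb Z^d$ with $\|x-y\|\le r$, $\mathrm d_G(x,y)\le r$, $\mathrm d_L(x,y)\le r$, respectively. Suppose that $\mathbb P(W>t)=\ell(t)/t^{\tau-1}$ for all $t>0$, where $\ell$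 is slowly varying at infinity and $\gamma:=\alpha(\tau-1)/d>2$; or else that $W$ has a tail thinner than every power law, that is, $t^p\,\mathbb P(W>t)\to 0$ as $t\to\infty$ for every $p\in\mathbb R$ (the case $\gamma=\infty$). Suppose also that $F_L(0)=0$. Then there are deterministic constants $C,\widetilde C>0$, depending only on $d,\alpha,\lambda$ and the distributions of $W$ and $L$, and, for every $x\in\mathbb Z^d$, random variables $n_0(x)\in\mathbb N$ and $t_0(x)\in\mathbb R$ such that, for every $x\in\mathbb Z^d$, almost surely $$B_n^G(x)\subset B^2_{\exp\{Cn\}}(x)\ \text{ for all integers } n\ge n_0(x),\qquad B_t^L(x)\subset B^2_{\exp\{\widetilde C t\}}(x)\ \text{ for all real } t\ge t_0(x).$$ -/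

import Mathlib

open MeasureTheory ProbabilityTheory Filter Topology Set

noncomputable section

namespace ScaleFreePercolation

/-- The vertex set `ℤ^d`. -/
abbrev Lattice (d : ℕ) : Type := Fin d → ℤ

/-- The Euclidean distance `‖x - y‖` between two points of `ℤ^d`. -/
def euclDist {d : ℕ} (x y : Lattice d) : ℝ :=
  ‖(WithLp.toLp 2 (fun i => ((x i - y i : ℤ) : ℝ)) : EuclideanSpace ℝ (Fin d))‖

theorem euclDist_comm {d : ℕ} (x y : Lattice d) : euclDist x y = euclDist y x := by
  unfold euclDist
  rw [← norm_neg]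
  congr 1
  ext i
  simp

/-- The conditional probability, given the vertex-weights `w`, that the edge between `x` and `y`
is present: nearest neighbours are always connected, and other pairs with probability
`1 - exp (-lam * w x * w y / ‖x - y‖ ^ α)`. -/
def connProb {d : ℕ} (α lam : ℝ) (w : Lattice d → ℝ) (x y : Lattice d) : ℝ :=
  if euclDist x y = 1 then 1
  else 1 - Real.exp (-(lam * (w x * w y / euclDist x y ^ α)))

theorem connProb_comm {d : ℕ} (α lam : ℝ) (w : Lattice d → ℝ) (x y : Lattice d) :
    connProb α lam w x y = connProb α lam w y x := by
  unfold connProb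
  rw [euclDist_comm, mul_comm (w x)]

/-- The connection probability as a function of the unordered pair. -/
def edgeProb {d : ℕ} (α lam : ℝ) (w : Lattice d → ℝ) : Sym2 (Lattice d) → ℝ :=
  Sym2.lift ⟨connProb α lam w, connProb_comm α lam w⟩

/-- `IsSFP α lam νW νL μ W G L`: on the probability space `(Ω, μ)`, the vertex-weights `W x`, the
random simple graph `G` on `ℤ^d` and the edge-weights `L e` form a weighted scale-free percolation
model with long-range parameter `α`, percolation parameter `lam`, vertex-weight distribution `νW`
and edge-weight distribution `νL`. (An edge-weight is attached to every unordered pair; only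
those on the edges of `G` are ever used.) -/
structure IsSFP {d : ℕ} (α lam : ℝ) (νW νL : Measure ℝ) {Ω : Type*} [MeasurableSpace Ω]
    (μ : Measure Ω) (W : Lattice d → Ω → ℝ) (G : Ω → SimpleGraph (Lattice d))
    (L : Sym2 (Lattice d) → Ω → ℝ) : Prop where
  measurable_W : ∀ x, Measurable (W x)
  measurable_G : ∀ e, MeasurableSet {ω | e ∈ (G ω).edgeSet}
  measurable_L : ∀ e, Measurable (L e)
  /-- The vertex-weights are i.i.d. with law `νW`. -/
  law_W : ∀ x, μ.map (W x) = νW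
  indep_W : iIndepFun W μ
  /-- Given all vertex-weights, the edges are present independently of each other, with
  probabilities `edgeProb`. -/
  cond_edges : ∀ S : Finset (Sym2 (Lattice d)), (∀ e ∈ S, ¬ e.IsDiag) →
    μ⟦{ω | ∀ e ∈ S, e ∈ (G ω).edgeSet} |
        MeasurableSpace.comap (fun ω x => W x ω) MeasurableSpace.pi⟧
      =ᵐ[μ] fun ω => ∏ e ∈ S, edgeProb α lam (fun x => W x ω) e
  /-- The edge-weights are i.i.d. with law `νL` ... -/
  law_L : ∀ e, μ.map (L e) = νL
  indep_L : iIndepFun L μ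
  /-- ... and independent of the vertex-weights and the graph. -/
  indep_WG_L : IndepFun
    (fun ω => ((fun x => W x ω), (fun e => e ∈ (G ω).edgeSet)) :
      Ω → (Lattice d → ℝ) × (Sym2 (Lattice d) → Prop))
    (fun ω e => L e ω) μ

/-- `ℓ` varies slowly at infinity. -/
def SlowlyVarying (ℓ : ℝ → ℝ) : Prop :=
  ∀ c : ℝ, 0 < c → Tendsto (fun t => ℓ (c * t) / ℓ t) atTop (𝓝 1)

/-- `P(W > t) = ℓ(t) / t ^ (τ - 1)` for a slowly varying function `ℓ`, where `W` has law `ν`. -/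
def PowerLawTail (ν : Measure ℝ) (τ : ℝ) : Prop :=
  ∃ ℓ : ℝ → ℝ, SlowlyVarying ℓ ∧ ∀ t : ℝ, 0 < t → ν.real (Ioi t) = ℓ t / t ^ (τ - 1)

/-- The tail of `ν` is thinner than every power law. -/
def ThinnerThanPowerLaw (ν : Measure ℝ) : Prop :=
  ∀ p : ℝ, Tendsto (fun t => t ^ p * ν.real (Ioi t)) atTop (𝓝 0)

/-- The `L`-distance: the infimum of the `L`-lengths of the paths of `G` from `x` to `y`. -/
def lDist {d : ℕ} (G : SimpleGraph (Lattice d)) (L : Sym2 (Lattice d) → ℝ)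
    (x y : Lattice d) : EReal :=
  ⨅ p : G.Path x y, ((((p : G.Walk x y).edges.map L).sum : ℝ) : EReal)

/-- The Euclidean ball in `ℤ^d`. -/
def euclBall {d : ℕ} (x : Lattice d) (r : ℝ) : Set (Lattice d) := {y | euclDist x y ≤ r}

/-- The ball for the graph distance. -/
def graphBall {d : ℕ} (G : SimpleGraph (Lattice d)) (x : Lattice d) (n : ℕ) :
    Set (Lattice d) := {y | G.edist x y ≤ n}

/-- The ball for the `L`-distance. -/
def lBall {d : ℕ} (G : SimpleGraph (Lattice d)) (L : Sym2 (Lattice d) → ℝ)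
    (x : Lattice d) (t : ℝ) : Set (Lattice d) := {y | lDist G L x y ≤ (t : EReal)}

end ScaleFreePercolation

end

/-!
The proof is a first-moment argument over self-avoiding paths. For exponents `θ, ε > 0` let `Y x` be
the sum, over all self-avoiding paths of the graph that start at `x`, of the product over the steps
`{a, b}` of `exp (-θ L) (1 + ‖a - b‖) ^ ε` (`weightedPathSum`). If `d_L(x, y) ≤ t`, then some path
from `x` to `y` has length below `t + 1`, and since the product of the factors `1 + ‖a - b‖` along
a path dominates `1 + ‖x - y‖`, this path alone gives
`(1 + ‖x - y‖) ^ ε ≤ exp (θ (t + 1)) Y x` (`ofReal_rpow_le_of_lDist_le`). So as soon as `Y x` is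
almost surely finite, the `L`-ball of radius `t` lies in the Euclidean ball of radius
`exp ((θ + 1) t / ε)` for all `t ≥ log (Y x) + θ`.

In fact `Y x` has finite expectation (`IsSFP.lintegral_weightedPathSum_lt_top`).
* For `0 ≤ s ≤ 1`, the connection probability at distance `r` is at most
  `A (w w') ^ s (1 + r) ^ (-α s)` (`enorm_connProb_le`).
* Along a self-avoiding path each vertex-weight enters at most twice, so a path with `k` steps is
  present with probability at most `A ^ k M ^ (k + 1) ∏ (1 + r) ^ (-α s)`, where `M` is the second
  moment of `W ^ s` (`IsSFP.measure_pathOpen_le`). Because `γ > 2`, there is such an `s` with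
  `α s > d` and `M < ∞` (`exists_moment_exponent`).
* The edge-weights are independent of the presence of the path and contribute `φ ^ k`, with `φ` the
  Laplace transform of `L` at `θ` (`IsSFP.lintegral_indicator_pathOpen`).
* With `ε < α s - d`, the sum `S` of `(1 + ‖z‖) ^ (ε - α s)` over the lattice is finite
  (`summable_one_add_euclDist_rpow`), and `E (Y x)` is at most `M ∑ (A M S φ) ^ k`. The ratio is
  less than `1` for large `θ`, since `F_L(0) = 0` makes `φ` tend to `0`.

The statement on graph-distance balls is the one on `L`-balls for the constant edge-weight `1`.
-/

namespace ScaleFreePercolation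

open scoped ENNReal

/-! ### Vertex sequences and products over their steps -/

section Paths

variable {V : Type*}

/-- The unordered pairs of consecutive vertices of the vertex sequence `x :: l`. -/
def pathEdges : V → List V → List (Sym2 V)
  | _, [] => []
  | x, y :: l => s(x, y) :: pathEdges y l

theorem mem_of_mem_pathEdges {x a : V} {l : List V} {e : Sym2 V} (he : e ∈ pathEdges x l)
    (ha : a ∈ e) : a ∈ x :: l := by
  induction l generalizing x with
  | nil => simp [pathEdges] at he
  | cons y l ih =>
    rw [pathEdges, List.mem_cons] at he
    rcases he with rfl | he
    · rcases Sym2.mem_iff.1 ha with rfl | rfl <;> simp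
    · exact List.mem_cons_of_mem _ (ih he)

theorem nodup_pathEdges {x : V} {l : List V} (h : (x :: l).Nodup) : (pathEdges x l).Nodup := by
  induction l generalizing x with
  | nil => simp [pathEdges]
  | cons y l ih =>
    rw [List.nodup_cons] at h
    refine List.nodup_cons.2 ⟨fun he => h.1 ?_, ih h.2⟩
    exact mem_of_mem_pathEdges he (Sym2.mem_mk_left x y)

theorem not_isDiag_of_mem_pathEdges {x : V} {l : List V} (h : (x :: l).Nodup) {e : Sym2 V}
    (he : e ∈ pathEdges x l) : ¬ e.IsDiag := by
  induction l generalizing x with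
  | nil => simp [pathEdges] at he
  | cons y l ih =>
    rw [List.nodup_cons] at h
    rw [pathEdges, List.mem_cons] at he
    rcases he with rfl | he
    · rw [Sym2.mk_isDiag_iff]
      rintro rfl
      exact h.1 (by simp)
    · exact ih h.2 he

theorem edges_eq_pathEdges {G : SimpleGraph V} {x y : V} (p : G.Walk x y) :
    p.edges = pathEdges x p.support.tail := by
  induction p with
  | nil => rfl
  | cons h p ih =>
    rw [SimpleGraph.Walk.edges_cons, SimpleGraph.Walk.support_cons, List.tail_cons,
      ← p.cons_tail_support, pathEdges, ih]

/-- The product of `f` over the consecutive pairs of the vertex sequence `x :: l`. -/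
noncomputable def pathProd (f : V → V → ℝ≥0∞) : V → List V → ℝ≥0∞
  | _, [] => 1
  | x, y :: l => f x y * pathProd f y l

theorem prod_map_pathEdges (g : Sym2 V → ℝ≥0∞) (x : V) (l : List V) :
    ((pathEdges x l).map g).prod = pathProd (fun a b => g s(a, b)) x l := by
  induction l generalizing x with
  | nil => rfl
  | cons y l ih => simp [pathEdges, pathProd, ih]

theorem pathProd_mul (f g : V → V → ℝ≥0∞) (x : V) (l : List V) :
    pathProd (fun a b => f a b * g a b) x l = pathProd f x l * pathProd g x l := by
  induction l generalizing x with
  | nil => simp [pathProd]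
  | cons y l ih => simp only [pathProd, ih]; ring

theorem pathProd_const (c : ℝ≥0∞) (x : V) (l : List V) :
    pathProd (fun _ _ => c) x l = c ^ l.length := by
  induction l generalizing x with
  | nil => simp [pathProd]
  | cons y l ih => simp only [pathProd, ih, List.length_cons]; ring

theorem tsum_pathProd_length_le {f : V → V → ℝ≥0∞} {ρ : ℝ≥0∞} (hf : ∀ x, ∑' y, f x y ≤ ρ)
    (n : ℕ) (x : V) : ∑' l : List V, (if l.length = n then pathProd f x l else 0) ≤ ρ ^ n := by
  induction n generalizing x with
  | zero =>
    rw [tsum_eq_single []]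
    · simp [pathProd]
    · intro l hl
      simp [hl]
  | succ n ih =>
    have hinj : Function.Injective (fun q : V × List V => q.1 :: q.2) := by
      rintro ⟨a, l⟩ ⟨b, m⟩ h
      simpa using h
    rw [← hinj.tsum_eq]
    · calc ∑' q : V × List V, (if (q.1 :: q.2).length = n + 1 then pathProd f x (q.1 :: q.2) else 0)
          = ∑' y, f x y * ∑' l : List V, (if l.length = n then pathProd f y l else 0) := by
            rw [ENNReal.tsum_prod']
            refine tsum_congr fun y => ?_
            rw [← ENNReal.tsum_mul_left]
            refine tsum_congr fun l => ?_
            simp [pathProd]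
        _ ≤ ∑' y, f x y * ρ ^ n := ENNReal.tsum_le_tsum fun y => mul_le_mul_right (ih y) _
        _ ≤ ρ ^ (n + 1) := by
            rw [ENNReal.tsum_mul_right, pow_succ']
            exact mul_le_mul_left (hf x) _
    · intro l hl
      cases l with
      | nil => simp at hl
      | cons y l => exact ⟨(y, l), rfl⟩

/-- If the one-step sums of `f` are at most `ρ`, then the sum over all vertex sequences from `x`
is at most a geometric series in `ρ`. -/
theorem tsum_pathProd_le {f : V → V → ℝ≥0∞} {ρ : ℝ≥0∞} (hf : ∀ x, ∑' y, f x y ≤ ρ) (x : V) :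
    ∑' l : List V, pathProd f x l ≤ (1 - ρ)⁻¹ := by
  calc ∑' l : List V, pathProd f x l
      = ∑' l : List V, ∑' n : ℕ, (if l.length = n then pathProd f x l else 0) := by
        refine tsum_congr fun l => ?_
        rw [tsum_eq_single l.length]
        · simp
        · intro n hn
          simp [hn.symm]
    _ = ∑' n : ℕ, ∑' l : List V, (if l.length = n then pathProd f x l else 0) :=
        ENNReal.tsum_comm
    _ ≤ ∑' n : ℕ, ρ ^ n := ENNReal.tsum_le_tsum fun n => tsum_pathProd_length_le hf n x
    _ = (1 - ρ)⁻¹ := ENNReal.tsum_geometric ρ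

end Paths

/-! ### Distances, lattice sums and connection probabilities -/

section Lattice

variable {d : ℕ}

theorem euclDist_nonneg (x y : Lattice d) : 0 ≤ euclDist x y := norm_nonneg _

theorem euclDist_self (x : Lattice d) : euclDist x x = 0 := by
  have : (fun i => ((x i - x i : ℤ) : ℝ)) = (0 : Fin d → ℝ) := by ext; simp
  rw [euclDist, this]
  simp

theorem euclDist_triangle (x y z : Lattice d) :
    euclDist x z ≤ euclDist x y + euclDist y z := by
  unfold euclDist
  refine le_trans (le_of_eq ?_) (norm_add_le _ _)
  congr 1
  ext i
  simp

theorem one_le_euclDist {x y : Lattice d} (h : x ≠ y) : 1 ≤ euclDist x y := by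
  obtain ⟨i, hi⟩ := Function.ne_iff.1 h
  have h1 : (1 : ℝ) ≤ |((x i - y i : ℤ) : ℝ)| := by
    exact_mod_cast Int.one_le_abs (sub_ne_zero.2 hi)
  exact h1.trans (PiLp.norm_apply_le (p := 2)
    (WithLp.toLp 2 (fun i => ((x i - y i : ℤ) : ℝ)) : EuclideanSpace ℝ (Fin d)) i)

/-- The product of the factors `1 + ‖z‖` over the steps `z` of a path dominates
`1 + ‖x - y‖` for the endpoints `x` and `y`. -/
theorem ofReal_one_add_euclDist_rpow_le_pathProd {ε : ℝ} (hε : 0 ≤ ε) (x : Lattice d)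
    (l : List (Lattice d)) :
    ENNReal.ofReal ((1 + euclDist x ((x :: l).getLast (by simp))) ^ ε) ≤
      pathProd (fun a b => ENNReal.ofReal ((1 + euclDist a b) ^ ε)) x l := by
  induction l generalizing x with
  | nil => simp [pathProd, euclDist_self]
  | cons y l ih =>
    rw [pathProd]
    refine le_trans ?_ (mul_le_mul_right (ih y) _)
    rw [List.getLast_cons (by simp)]
    set z := (y :: l).getLast (by simp)
    have h1 := euclDist_nonneg x y
    have h2 := euclDist_nonneg y z
    have h3 := euclDist_nonneg x z
    rw [← ENNReal.ofReal_mul (by positivity), ← Real.mul_rpow (by positivity) (by positivity)]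
    refine ENNReal.ofReal_le_ofReal (Real.rpow_le_rpow (by positivity) ?_ hε)
    nlinarith [euclDist_triangle x y z, mul_nonneg h1 h2]

theorem summable_one_add_euclDist_rpow {β : ℝ} (hβ : (d : ℝ) < β) :
    Summable fun z : Lattice d => (1 + euclDist 0 z) ^ (-β) := by
  let b := (EuclideanSpace.basisFun (Fin d) ℝ).toBasis
  let Λ : Submodule ℤ (EuclideanSpace ℝ (Fin d)) := Submodule.span ℤ (Set.range b)
  have hrank : Module.finrank ℤ Λ = d := by
    rw [ZLattice.rank ℝ Λ]
    simp
  have hs : Summable fun z : Λ => ‖z‖ ^ (-β) := ZLattice.summable_norm_rpow Λ _ (by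
    rw [hrank]; linarith)
  have hmem : ∀ z : Lattice d,
      (WithLp.toLp 2 (fun i => ((0 - z i : ℤ) : ℝ)) : EuclideanSpace ℝ (Fin d)) ∈ Λ := by
    intro z
    refine (b.mem_span_iff_repr_mem ℤ _).2 fun i => ?_
    exact ⟨0 - z i, by simp [b]⟩
  let φ : Lattice d → Λ := fun z => ⟨_, hmem z⟩
  have hφ : Function.Injective φ := by
    intro z w h
    have h' := congrArg (fun v : Λ => (v : EuclideanSpace ℝ (Fin d))) h
    ext i
    have := congrArg (fun v : EuclideanSpace ℝ (Fin d) => v i) h'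
    simpa [φ] using this
  have hs' := hs.comp_injective hφ
  refine Summable.of_norm_bounded_eventually (g := fun z => ‖φ z‖ ^ (-β)) hs' ?_
  have hfin : ({0} : Set (Lattice d)).Finite := Set.finite_singleton 0
  filter_upwards [hfin.compl_mem_cofinite] with z hz
  have h1 : 1 ≤ euclDist 0 z := one_le_euclDist (Ne.symm hz)
  have h2 : ‖φ z‖ = euclDist 0 z := rfl
  rw [h2, Real.norm_of_nonneg (by positivity)]
  have : (0:ℝ) ≤ d := Nat.cast_nonneg d
  exact Real.rpow_le_rpow_of_nonpos (by linarith) (by linarith) (by linarith)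

theorem tsum_one_add_euclDist_rpow (β : ℝ) (x : Lattice d) :
    ∑' y, ENNReal.ofReal ((1 + euclDist x y) ^ (-β)) =
      ∑' z : Lattice d, ENNReal.ofReal ((1 + euclDist 0 z) ^ (-β)) := by
  rw [← (Equiv.addLeft x).tsum_eq]
  refine tsum_congr fun z => ?_
  have : euclDist x (x + z) = euclDist 0 z := by
    unfold euclDist
    congr 2
    ext i
    simp
  rw [Equiv.coe_addLeft, this]

/-- The bound comes from `1 - exp (-u) ≤ min 1 u ≤ u ^ s` for `0 ≤ s ≤ 1` and from `1 + r ≤ 2 r` for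
`r ≥ 1`. Nearest neighbours satisfy it too, since the vertex-weights are at least `1`. -/
theorem enorm_connProb_le {α lam s : ℝ} (hα : 0 ≤ α) (hlam : 0 < lam) (hs : 0 ≤ s) (hs1 : s ≤ 1)
    {w : Lattice d → ℝ} {x y : Lattice d} (hxy : x ≠ y) (hx : 1 ≤ w x) (hy : 1 ≤ w y) :
    ‖connProb α lam w x y‖ₑ ≤
      ENNReal.ofReal (max 1 (lam ^ s) * 2 ^ (α * s)) *
        ENNReal.ofReal ((1 + euclDist x y) ^ (-(α * s))) *
        (ENNReal.ofReal (w x ^ s) * ENNReal.ofReal (w y ^ s)) := by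
  have hr := one_le_euclDist hxy
  set r := euclDist x y with hrdef
  have hwx : 1 ≤ w x ^ s := Real.one_le_rpow hx hs
  have hwy : 1 ≤ w y ^ s := Real.one_le_rpow hy hs
  have hwxy : 1 ≤ w x ^ s * w y ^ s := one_le_mul_of_one_le_of_one_le hwx hwy
  have hr0 : 0 < r := by linarith
  rw [← ENNReal.ofReal_mul (by positivity), ← ENNReal.ofReal_mul (by positivity),
    ← ENNReal.ofReal_mul (by positivity), Real.enorm_eq_ofReal_abs]
  refine ENNReal.ofReal_le_ofReal ?_
  have hrr : r ^ (-(α * s)) ≤ 2 ^ (α * s) * (1 + r) ^ (-(α * s)) := by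
    have h : r ^ (-(α * s)) ≤ ((1 + r) / 2) ^ (-(α * s)) :=
      Real.rpow_le_rpow_of_nonpos (by linarith) (by linarith) (by
        have := mul_nonneg hα hs; linarith)
    refine h.trans (le_of_eq ?_)
    rw [Real.div_rpow (by linarith) (by norm_num), Real.rpow_neg (by norm_num : (0:ℝ) ≤ 2)]
    field_simp
  suffices h : |connProb α lam w x y| ≤
      max 1 (lam ^ s) * r ^ (-(α * s)) * (w x ^ s * w y ^ s) by
    refine h.trans ?_
    rw [mul_assoc (max 1 (lam ^ s)) (2 ^ (α * s))]
    exact mul_le_mul_of_nonneg_right (mul_le_mul_of_nonneg_left hrr (by positivity))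
      (by positivity)
  unfold connProb
  split_ifs with h1
  · rw [← hrdef] at h1
    rw [h1, Real.one_rpow, abs_one, mul_one]
    exact one_le_mul_of_one_le_of_one_le (le_max_left _ _) hwxy
  · rw [← hrdef]
    set u := lam * (w x * w y / r ^ α) with hu
    have hu0 : 0 < u := by positivity
    have hexp : Real.exp (-u) ≤ 1 := Real.exp_le_one_iff.2 (by linarith)
    rw [abs_of_nonneg (by linarith)]
    have hus : 1 - Real.exp (-u) ≤ u ^ s := by
      rcases le_total 1 u with h | h
      · have := Real.one_le_rpow h hs
        linarith [Real.exp_pos (-u)]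
      · have h2 : u ^ (1 : ℝ) ≤ u ^ s := Real.rpow_le_rpow_of_exponent_ge hu0 h hs1
        rw [Real.rpow_one] at h2
        linarith [Real.one_sub_le_exp_neg u]
    refine hus.trans ?_
    have : u ^ s = lam ^ s * r ^ (-(α * s)) * (w x ^ s * w y ^ s) := by
      rw [hu, Real.mul_rpow hlam.le (by positivity), Real.div_rpow (by positivity) (by positivity),
        Real.mul_rpow (by positivity) (by positivity), ← Real.rpow_mul hr0.le,
        Real.rpow_neg hr0.le]
      field_simp
    rw [this]
    gcongr
    exact le_max_right _ _

end Lattice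

/-! ### Moments of the vertex-weights and Laplace transform of the edge-weights -/

/-- A polynomial decay of order `p` of the tail along a dyadic sequence gives finite moments of
every order `q < p`. -/
theorem lintegral_rpow_lt_top_of_dyadic_tail {ν : Measure ℝ} [IsProbabilityMeasure ν]
    (hν : ∀ᵐ w ∂ν, 1 ≤ w) {t₀ p q M : ℝ} (ht₀ : 0 < t₀) (hq : 0 ≤ q) (hqp : q < p)
    (htail : ∀ k : ℕ, ν.real (Ioi (2 ^ k * t₀)) ≤ M * (2 ^ (-p)) ^ k) :
    ∫⁻ w, ENNReal.ofReal (w ^ q) ∂ν < ∞ := by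
  have hbound : ∀ᵐ w ∂ν, ENNReal.ofReal (w ^ q) ≤ ENNReal.ofReal ((2 * t₀) ^ q) +
      ∑' k : ℕ, (Ioi (2 ^ k * t₀)).indicator
        (fun _ => ENNReal.ofReal ((2 ^ k * (4 * t₀)) ^ q)) w := by
    filter_upwards [hν] with w hw
    rcases le_total w (2 * t₀) with h | h
    · exact le_add_right (ENNReal.ofReal_le_ofReal (Real.rpow_le_rpow (by linarith) h hq))
    · refine le_add_left ?_
      -- The dyadic scale `n` has `2 ^ (n + 1) * t₀ ≤ w < 2 ^ (n + 2) * t₀`, so the bound `2 ^ n * t₀`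
      -- is exceeded strictly, as the open half-line requires.
      obtain ⟨n, hn1, hn2⟩ := exists_nat_pow_near (x := w / (2 * t₀)) (y := 2)
        ((one_le_div (by positivity)).2 h) (by norm_num)
      rw [le_div_iff₀ (by positivity)] at hn1
      rw [div_lt_iff₀ (by positivity)] at hn2
      refine le_trans ?_ (ENNReal.le_tsum n)
      have hpos : 0 < (2:ℝ) ^ n * t₀ := by positivity
      rw [indicator_of_mem (mem_Ioi.2 (by linarith))]
      refine ENNReal.ofReal_le_ofReal (Real.rpow_le_rpow (by linarith) ?_ hq)
      rw [pow_succ] at hn2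
      linarith
  have hratio : (2:ℝ) ^ (q - p) < 1 := Real.rpow_lt_one_of_one_lt_of_neg (by norm_num) (by linarith)
  have hsum : Summable fun k : ℕ => (4 * t₀) ^ q * M * ((2:ℝ) ^ (q - p)) ^ k :=
    (summable_geometric_of_lt_one (by positivity) hratio).mul_left _
  refine lt_of_le_of_lt (lintegral_mono_ae hbound) ?_
  rw [lintegral_add_left measurable_const, lintegral_const, measure_univ, mul_one,
    lintegral_tsum fun k => (measurable_const.indicator measurableSet_Ioi).aemeasurable]
  refine ENNReal.add_lt_top.2 ⟨ENNReal.ofReal_lt_top, lt_of_le_of_lt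
    (ENNReal.tsum_le_tsum fun k => ?_) hsum.tsum_ofReal_lt_top⟩
  rw [lintegral_indicator_const measurableSet_Ioi, ← ofReal_measureReal,
    ← ENNReal.ofReal_mul (by positivity)]
  refine ENNReal.ofReal_le_ofReal ?_
  calc ((2:ℝ) ^ k * (4 * t₀)) ^ q * ν.real (Ioi (2 ^ k * t₀))
      ≤ ((2:ℝ) ^ k * (4 * t₀)) ^ q * (M * (2 ^ (-p)) ^ k) := by
        gcongr
        exact htail k
    _ = (4 * t₀) ^ q * M * ((2:ℝ) ^ (q - p)) ^ k := by
        have h1 : ((2:ℝ) ^ k) ^ q = (2 ^ q) ^ k := by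
          rw [← Real.rpow_natCast, ← Real.rpow_natCast, ← Real.rpow_mul (by norm_num),
            ← Real.rpow_mul (by norm_num), mul_comm]
        rw [Real.mul_rpow (by positivity) (by positivity), h1, sub_eq_add_neg,
          Real.rpow_add (by norm_num), mul_pow]
        ring

theorem PowerLawTail.lintegral_rpow_lt_top {ν : Measure ℝ} [IsProbabilityMeasure ν]
    (hν : ∀ᵐ w ∂ν, 1 ≤ w) {τ q : ℝ} (h : PowerLawTail ν τ) (hq : 0 ≤ q) (hqτ : q < τ - 1) :
    ∫⁻ w, ENNReal.ofReal (w ^ q) ∂ν < ∞ := by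
  obtain ⟨ℓ, hℓ, hF⟩ := h
  obtain ⟨p, hqp, hpτ⟩ := exists_between hqτ
  have hlim := hℓ 2 (by norm_num)
  have hone : (1:ℝ) < 2 ^ (τ - 1 - p) := Real.one_lt_rpow (by norm_num) (by linarith)
  obtain ⟨t₁, ht₁⟩ := eventually_atTop.1
    ((hlim.eventually (gt_mem_nhds hone)).and (hlim.eventually (lt_mem_nhds zero_lt_one)))
  have hstep : ∀ t, max 1 t₁ ≤ t → ν.real (Ioi (2 * t)) ≤ 2 ^ (-p) * ν.real (Ioi t) := by
    intro t ht
    have ht0 : 0 < t := lt_of_lt_of_le zero_lt_one ((le_max_left _ _).trans ht)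
    obtain ⟨ha, hb⟩ := ht₁ t ((le_max_right _ _).trans ht)
    have hℓ0 : 0 ≤ ℓ t := by
      have : 0 ≤ ℓ t / t ^ (τ - 1) := hF t ht0 ▸ measureReal_nonneg
      exact (div_nonneg_iff.1 this).elim (fun h => h.1)
        (fun h => absurd h.2 (not_le.2 (by positivity)))
    -- `ℓ t ≠ 0`, because the quotient by `0` would be `0`.
    have hℓpos : 0 < ℓ t := lt_of_le_of_ne hℓ0 (by rintro h; rw [← h] at hb; simp at hb)
    rw [div_lt_iff₀ hℓpos] at ha
    rw [hF _ ht0, hF _ (by positivity), Real.mul_rpow (by norm_num) ht0.le]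
    calc ℓ (2 * t) / (2 ^ (τ - 1) * t ^ (τ - 1))
        ≤ 2 ^ (τ - 1 - p) * ℓ t / (2 ^ (τ - 1) * t ^ (τ - 1)) := by gcongr
      _ = 2 ^ (-p) * (ℓ t / t ^ (τ - 1)) := by
        rw [show τ - 1 - p = (τ - 1) + -p by ring, Real.rpow_add (by norm_num)]
        field_simp
  refine lintegral_rpow_lt_top_of_dyadic_tail hν (t₀ := max 1 t₁) (M := 1)
    (lt_of_lt_of_le zero_lt_one (le_max_left _ _)) hq hqp fun k => ?_
  induction k with
  | zero => simp
  | succ k ih =>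
    have h1 : max 1 t₁ ≤ 2 ^ k * max 1 t₁ :=
      le_mul_of_one_le_left (by positivity) (one_le_pow₀ (by norm_num))
    rw [show (2:ℝ) ^ (k + 1) * max 1 t₁ = 2 * (2 ^ k * max 1 t₁) by ring]
    refine (hstep _ h1).trans ?_
    rw [one_mul, pow_succ'] at *
    gcongr

theorem ThinnerThanPowerLaw.lintegral_rpow_lt_top {ν : Measure ℝ} [IsProbabilityMeasure ν]
    (hν : ∀ᵐ w ∂ν, 1 ≤ w) {q : ℝ} (h : ThinnerThanPowerLaw ν) (hq : 0 ≤ q) :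
    ∫⁻ w, ENNReal.ofReal (w ^ q) ∂ν < ∞ := by
  obtain ⟨t₁, ht₁⟩ := eventually_atTop.1 ((h (q + 1)).eventually (gt_mem_nhds zero_lt_one))
  have hpos : 0 < max 1 t₁ := lt_of_lt_of_le zero_lt_one (le_max_left _ _)
  refine lintegral_rpow_lt_top_of_dyadic_tail hν (t₀ := max 1 t₁)
    (M := (max 1 t₁) ^ (-(q + 1))) hpos hq (lt_add_one q) fun k => ?_
  have h1 : max 1 t₁ ≤ 2 ^ k * max 1 t₁ :=
    le_mul_of_one_le_left (by positivity) (one_le_pow₀ (by norm_num))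
  have h2 := (ht₁ _ ((le_max_right _ _).trans h1)).le
  set t := 2 ^ k * max 1 t₁ with ht
  have htpos : 0 < t := by positivity
  rw [← le_div_iff₀' (by positivity), one_div, ← Real.rpow_neg htpos.le] at h2
  refine h2.trans (le_of_eq ?_)
  rw [ht, Real.mul_rpow (by positivity) hpos.le, ← Real.rpow_natCast, ← Real.rpow_natCast,
    ← Real.rpow_mul (by norm_num), ← Real.rpow_mul (by norm_num), mul_comm,
    mul_comm (k : ℝ)]

/-- The condition `γ > 2` leaves room for an exponent `s > d / α` such that `W ^ s` has a finite
second moment. -/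
theorem exists_moment_exponent {d : ℕ} {α : ℝ} (hα : (d : ℝ) < α)
    {ν : Measure ℝ} [IsProbabilityMeasure ν] (hν : ∀ᵐ w ∂ν, 1 ≤ w)
    (htail : (∃ τ : ℝ, PowerLawTail ν τ ∧ 2 < α * (τ - 1) / d) ∨ ThinnerThanPowerLaw ν)
    (hd : 0 < d) :
    ∃ s : ℝ, 0 ≤ s ∧ s ≤ 1 ∧ (d : ℝ) < α * s ∧
      ∫⁻ w, ENNReal.ofReal (w ^ s) ^ 2 ∂ν < ∞ := by
  have hd' : (0:ℝ) < d := Nat.cast_pos.2 hd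
  have hα0 : 0 < α := hd'.trans hα
  have hsq : ∀ s : ℝ,
      ∫⁻ w, ENNReal.ofReal (w ^ s) ^ 2 ∂ν = ∫⁻ w, ENNReal.ofReal (w ^ (2 * s)) ∂ν := by
    intro s
    refine lintegral_congr_ae ?_
    filter_upwards [hν] with w hw
    rw [← ENNReal.ofReal_pow (by positivity), ← Real.rpow_natCast, ← Real.rpow_mul (by linarith)]
    congr 2
    push_cast
    ring
  simp only [hsq]
  rcases htail with ⟨τ, hτ, h2⟩ | h
  · rw [lt_div_iff₀ hd'] at h2
    have hlt : (d : ℝ) / α < min 1 ((τ - 1) / 2) := by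
      refine lt_min ((div_lt_one hα0).2 hα) ?_
      rw [div_lt_div_iff₀ hα0 (by norm_num)]
      linarith
    obtain ⟨s, hs1, hs2⟩ := exists_between hlt
    have hs0 : 0 < s := (by positivity : 0 < (d : ℝ) / α).trans hs1
    have hs3 := hs2.trans_le (min_le_right _ _)
    refine ⟨s, hs0.le, (hs2.trans_le (min_le_left _ _)).le, (div_lt_iff₀' hα0).1 hs1,
      hτ.lintegral_rpow_lt_top hν (by positivity) (by linarith)⟩
  · exact ⟨1, zero_le_one, le_rfl, by simpa using hα, h.lintegral_rpow_lt_top hν (by norm_num)⟩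

/-- If `ν` gives no mass to `(-∞, 0]`, its Laplace transform tends to `0` at infinity. -/
theorem tendsto_lintegral_exp_neg_mul {ν : Measure ℝ} [IsProbabilityMeasure ν]
    (hν : cdf ν 0 = 0) :
    Tendsto (fun n : ℕ => ∫⁻ w, ENNReal.ofReal (Real.exp (-(n * w))) ∂ν) atTop (𝓝 0) := by
  have hpos : ∀ᵐ w ∂ν, 0 < w := by
    rw [cdf_eq_real, measureReal_eq_zero_iff] at hν
    filter_upwards [measure_eq_zero_iff_ae_notMem.1 hν] with w hw
    simpa using hw
  have hlim := tendsto_lintegral_of_dominated_convergence (μ := ν)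
    (F := fun (n : ℕ) w => ENNReal.ofReal (Real.exp (-(n * w)))) (f := fun _ => 0)
    (fun _ => 1) (fun n => by fun_prop) ?_ (by simp) ?_
  · simpa using hlim
  · intro n
    filter_upwards [hpos] with w hw
    rw [← ENNReal.ofReal_one]
    refine ENNReal.ofReal_le_ofReal (Real.exp_le_one_iff.2 ?_)
    have : 0 ≤ (n : ℝ) * w := by positivity
    linarith
  · filter_upwards [hpos] with w hw
    rw [← ENNReal.ofReal_zero]
    refine ENNReal.tendsto_ofReal ?_
    refine Real.tendsto_exp_neg_atTop_nhds_zero.comp ?_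
    exact tendsto_natCast_atTop_atTop.atTop_mul_const hw

/-! ### The weighted path sum -/

section Functional

variable {d : ℕ}

/-- The event that all steps of the vertex sequence `x :: l` are edges of the graph. -/
def pathOpen {Ω : Type*} (G : Ω → SimpleGraph (Lattice d)) (x : Lattice d)
    (l : List (Lattice d)) : Set Ω := {ω | ∀ e ∈ pathEdges x l, e ∈ (G ω).edgeSet}

open Classical in
/-- The sum over all self-avoiding paths of the graph from `x` of the product, over the steps
`{a, b}` of the path, of `exp (-θ L) (1 + ‖a - b‖) ^ ε`. -/
noncomputable def weightedPathSum {Ω : Type*} (θ ε : ℝ) (G : Ω → SimpleGraph (Lattice d))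
    (L : Sym2 (Lattice d) → Ω → ℝ) (x : Lattice d) (ω : Ω) : ℝ≥0∞ :=
  ∑' l : List (Lattice d), if (x :: l).Nodup then
    (pathOpen G x l).indicator (fun ω =>
      ((pathEdges x l).map fun e => ENNReal.ofReal (Real.exp (-(θ * L e ω)))).prod *
        pathProd (fun a b => ENNReal.ofReal ((1 + euclDist a b) ^ ε)) x l) ω
  else 0

theorem one_le_weightedPathSum {Ω : Type*} (θ ε : ℝ) (G : Ω → SimpleGraph (Lattice d))
    (L : Sym2 (Lattice d) → Ω → ℝ) (x : Lattice d) (ω : Ω) :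
    1 ≤ weightedPathSum θ ε G L x ω := by
  refine le_trans (le_of_eq ?_) (ENNReal.le_tsum [])
  simp [pathOpen, pathEdges, pathProd]

theorem prod_map_ofReal_exp {ι : Type*} (θ : ℝ) (f : ι → ℝ) (l : List ι) :
    (l.map fun e => ENNReal.ofReal (Real.exp (-(θ * f e)))).prod =
      ENNReal.ofReal (Real.exp (-(θ * (l.map f).sum))) := by
  induction l with
  | nil => simp
  | cons a l ih =>
    rw [List.map_cons, List.prod_cons, ih, ← ENNReal.ofReal_mul (Real.exp_nonneg _),
      ← Real.exp_add, List.map_cons, List.sum_cons]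
    congr 2
    ring

/-- A single path of `L`-length less than `t + 1` from `x` to `y` already contributes
`exp (-θ (t + 1)) (1 + ‖x - y‖) ^ ε` to the weighted path sum. -/
theorem ofReal_rpow_le_of_lDist_le {Ω : Type*} {θ ε : ℝ} (hθ : 0 ≤ θ) (hε : 0 ≤ ε)
    {G : Ω → SimpleGraph (Lattice d)} {L : Sym2 (Lattice d) → Ω → ℝ} {x y : Lattice d} {ω : Ω}
    {t : ℝ} (h : lDist (G ω) (fun e => L e ω) x y ≤ (t : EReal)) :
    ENNReal.ofReal ((1 + euclDist x y) ^ ε) ≤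
      ENNReal.ofReal (Real.exp (θ * (t + 1))) * weightedPathSum θ ε G L x ω := by
  have hlt : lDist (G ω) (fun e => L e ω) x y < ((t + 1 : ℝ) : EReal) :=
    h.trans_lt (EReal.coe_lt_coe_iff.2 (lt_add_one t))
  obtain ⟨⟨p, hp⟩, hlen⟩ := iInf_lt_iff.1 hlt
  have hlen : (p.edges.map fun e => L e ω).sum < t + 1 := EReal.coe_lt_coe_iff.1 hlen
  have hsupp : x :: p.support.tail = p.support := p.cons_tail_support
  set l := p.support.tail with hl
  have hnodup : (x :: l).Nodup := hsupp ▸ hp.support_nodup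
  have hedges : p.edges = pathEdges x l := edges_eq_pathEdges p
  have hopen : ω ∈ pathOpen G x l := fun e he => p.edges_subset_edgeSet (hedges ▸ he)
  have hlast : (x :: l).getLast (by simp) = y := by
    simp only [hsupp]
    exact p.getLast_support
  have hterm : ENNReal.ofReal (Real.exp (-(θ * (p.edges.map fun e => L e ω).sum))) *
      ENNReal.ofReal ((1 + euclDist x y) ^ ε) ≤ weightedPathSum θ ε G L x ω := by
    refine le_trans ?_ (ENNReal.le_tsum l)
    rw [if_pos hnodup, indicator_of_mem hopen, prod_map_ofReal_exp, hedges]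
    refine mul_le_mul_right ?_ _
    have := ofReal_one_add_euclDist_rpow_le_pathProd hε x l
    rwa [hlast] at this
  refine le_trans ?_ (mul_le_mul_right hterm _)
  rw [← mul_assoc, ← ENNReal.ofReal_mul (Real.exp_nonneg _), ← Real.exp_add]
  refine le_mul_of_one_le_left zero_le ?_
  rw [← ENNReal.ofReal_one]
  refine ENNReal.ofReal_le_ofReal (Real.one_le_exp ?_)
  nlinarith [mul_le_mul_of_nonneg_left hlen.le hθ]

end Functional

/-! ### The expectation of the weighted path sum -/

section Expectation

variable {d : ℕ} {α lam : ℝ} {νW νL : Measure ℝ} {Ω : Type*} [MeasurableSpace Ω]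
  {μ : Measure Ω} {W : Lattice d → Ω → ℝ}
  {G : Ω → SimpleGraph (Lattice d)} {L : Sym2 (Lattice d) → Ω → ℝ}

theorem IsSFP.measurableSet_pathOpen (h : IsSFP α lam νW νL μ W G L) (x : Lattice d)
    (l : List (Lattice d)) : MeasurableSet (pathOpen G x l) := by
  have : pathOpen G x l = ⋂ e ∈ (pathEdges x l).toFinset, {ω | e ∈ (G ω).edgeSet} := by
    ext ω
    simp [pathOpen]
  rw [this]
  exact Finset.measurableSet_biInter _ fun e _ => h.measurable_G e

open Classical in
theorem IsSFP.measurable_weightedPathSum_term (h : IsSFP α lam νW νL μ W G L) (θ : ℝ) (c : ℝ≥0∞)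
    (x : Lattice d) (l : List (Lattice d)) :
    Measurable fun ω => if (x :: l).Nodup then (pathOpen G x l).indicator (fun ω =>
      ((pathEdges x l).map fun e => ENNReal.ofReal (Real.exp (-(θ * L e ω)))).prod * c) ω
      else 0 := by
  split_ifs with hl
  · refine Measurable.indicator ?_ (h.measurableSet_pathOpen x l)
    refine Measurable.mul_const ?_ _
    simp only [prod_map_ofReal_exp]
    have hsum : ∀ m : List (Sym2 (Lattice d)),
        Measurable fun ω => (m.map fun e => L e ω).sum := by
      intro m
      induction m with
      | nil => simp
      | cons e m ih =>
        simp only [List.map_cons, List.sum_cons]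
        exact (h.measurable_L e).add ih
    have := hsum (pathEdges x l)
    fun_prop
  · exact measurable_const

theorem IsSFP.measurable_weightedPathSum (h : IsSFP α lam νW νL μ W G L) (θ ε : ℝ)
    (x : Lattice d) : Measurable (weightedPathSum θ ε G L x) :=
  Measurable.tsum fun l => h.measurable_weightedPathSum_term θ _ x l

theorem IsSFP.measure_pathOpen_le_lintegral_prod [IsProbabilityMeasure μ]
    (h : IsSFP α lam νW νL μ W G L) {x : Lattice d}
    {l : List (Lattice d)} (hl : (x :: l).Nodup) :
    μ (pathOpen G x l) ≤
      ∫⁻ ω, pathProd (fun a b => ‖connProb α lam (fun v => W v ω) a b‖ₑ) x l ∂μ := by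
  have hset : {ω | ∀ e ∈ (pathEdges x l).toFinset, e ∈ (G ω).edgeSet} = pathOpen G x l := by
    ext ω
    simp [pathOpen]
  have hcond := h.cond_edges (pathEdges x l).toFinset fun e he =>
    not_isDiag_of_mem_pathEdges hl (List.mem_toFinset.1 he)
  rw [hset] at hcond
  have hm : MeasurableSpace.comap (fun ω x => W x ω) MeasurableSpace.pi ≤ ‹MeasurableSpace Ω› :=
    (measurable_pi_lambda _ h.measurable_W).comap_le
  have hreal : μ.real (pathOpen G x l) =
      ∫ ω, ∏ e ∈ (pathEdges x l).toFinset, edgeProb α lam (fun v => W v ω) e ∂μ := by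
    rw [← integral_congr_ae hcond, integral_condExp hm,
      integral_indicator_const _ (h.measurableSet_pathOpen x l), smul_eq_mul, mul_one]
  have hen : μ (pathOpen G x l) = ‖μ.real (pathOpen G x l)‖ₑ := by
    rw [Real.enorm_of_nonneg measureReal_nonneg, ofReal_measureReal]
  rw [hen, hreal]
  refine (enorm_integral_le_lintegral_enorm _).trans (le_of_eq (lintegral_congr fun ω => ?_))
  rw [List.prod_toFinset _ (nodup_pathEdges hl)]
  have hnorm : ∀ m : List ℝ, ‖m.prod‖ₑ = (m.map fun r => ‖r‖ₑ).prod := by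
    intro m
    induction m with
    | nil => simp
    | cons a m ih => simp [enorm_mul, ih]
  rw [hnorm, List.map_map]
  exact prod_map_pathEdges (fun e => ‖edgeProb α lam (fun v => W v ω) e‖ₑ) x l

/-- In a product over the steps of a path every vertex-weight occurs at most twice. The factor
`v x` on the left accounts for the second occurrence of the weight of the initial vertex. -/
theorem pathProd_mul_le {V : Type*} {p g : V → V → ℝ≥0∞} {v : V → ℝ≥0∞}
    (hv : ∀ a, 1 ≤ v a) (hp : ∀ a b, a ≠ b → p a b ≤ g a b * (v a * v b)) {x : V} {l : List V}
    (hl : (x :: l).Nodup) :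
    pathProd p x l * v x ≤ pathProd g x l * ((x :: l).map fun a => v a ^ 2).prod := by
  induction l generalizing x with
  | nil =>
    simp only [pathProd, one_mul, List.map_cons, List.map_nil, List.prod_cons, List.prod_nil,
      mul_one]
    exact le_self_pow (hv x) two_ne_zero
  | cons y l ih =>
    rw [List.nodup_cons] at hl
    have hxy : x ≠ y := fun h => hl.1 (by simp [h])
    rw [pathProd, pathProd, List.map_cons, List.prod_cons]
    calc p x y * pathProd p y l * v x
        ≤ g x y * (v x * v y) * pathProd p y l * v x := by gcongr; exact hp x y hxy
      _ = g x y * v x ^ 2 * (pathProd p y l * v y) := by ring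
      _ ≤ g x y * v x ^ 2 * (pathProd g y l * ((y :: l).map fun a => v a ^ 2).prod) := by
        exact mul_le_mul_right (ih hl.2) _
      _ = _ := by ring

theorem IsSFP.ae_one_le (h : IsSFP α lam νW νL μ W G L) (hW : ∀ᵐ w ∂νW, 1 ≤ w) :
    ∀ᵐ ω ∂μ, ∀ x, 1 ≤ W x ω := by
  refine ae_all_iff.2 fun x => ?_
  rw [← h.law_W x] at hW
  exact ae_of_ae_map (h.measurable_W x).aemeasurable hW

theorem IsSFP.measure_pathOpen_le [IsProbabilityMeasure μ]
    (h : IsSFP α lam νW νL μ W G L) (hW : ∀ᵐ w ∂νW, 1 ≤ w)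
    (hα : 0 ≤ α) (hlam : 0 < lam) {s : ℝ} (hs : 0 ≤ s) (hs1 : s ≤ 1) {x : Lattice d}
    {l : List (Lattice d)} (hl : (x :: l).Nodup) :
    μ (pathOpen G x l) ≤
      pathProd (fun a b => ENNReal.ofReal (max 1 (lam ^ s) * 2 ^ (α * s)) *
        ENNReal.ofReal ((1 + euclDist a b) ^ (-(α * s)))) x l *
        (∫⁻ w, ENNReal.ofReal (w ^ s) ^ 2 ∂νW) ^ (l.length + 1) := by
  have hmeas : Measurable fun w : ℝ => ENNReal.ofReal (w ^ s) ^ 2 := by fun_prop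
  refine (h.measure_pathOpen_le_lintegral_prod hl).trans ?_
  have hbound : ∀ᵐ ω ∂μ, pathProd (fun a b => ‖connProb α lam (fun v => W v ω) a b‖ₑ) x l ≤
      pathProd (fun a b => ENNReal.ofReal (max 1 (lam ^ s) * 2 ^ (α * s)) *
        ENNReal.ofReal ((1 + euclDist a b) ^ (-(α * s)))) x l *
        ∏ a ∈ (x :: l).toFinset, ENNReal.ofReal (W a ω ^ s) ^ 2 := by
    filter_upwards [h.ae_one_le hW] with ω hω
    have hv : ∀ a, 1 ≤ ENNReal.ofReal (W a ω ^ s) := fun a => by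
      rw [← ENNReal.ofReal_one]
      exact ENNReal.ofReal_le_ofReal (Real.one_le_rpow (hω a) hs)
    rw [List.prod_toFinset _ hl]
    exact (le_mul_of_one_le_right zero_le (hv x)).trans (pathProd_mul_le hv
      (fun a b hab => enorm_connProb_le hα hlam hs hs1 hab (hω a) (hω b)) hl)
  refine (lintegral_mono_ae hbound).trans (le_of_eq ?_)
  have hind : iIndepFun (fun a ω => ENNReal.ofReal (W a ω ^ s) ^ 2) μ :=
    h.indep_W.comp (fun _ w => ENNReal.ofReal (w ^ s) ^ 2) fun _ => hmeas
  have hmeasW : ∀ a, Measurable fun ω => ENNReal.ofReal (W a ω ^ s) ^ 2 :=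
    fun a => hmeas.comp (h.measurable_W a)
  rw [lintegral_const_mul _ (Finset.measurable_prod _ fun a _ => hmeasW a),
    lintegral_prod_eq_prod_lintegral_of_indepFun _ _ hind hmeasW]
  have hlaw : ∀ a, ∫⁻ ω, ENNReal.ofReal (W a ω ^ s) ^ 2 ∂μ =
      ∫⁻ w, ENNReal.ofReal (w ^ s) ^ 2 ∂νW := fun a => by
    rw [← h.law_W a, lintegral_map hmeas (h.measurable_W a)]
  rw [Finset.prod_congr rfl fun a _ => hlaw a, Finset.prod_const, List.toFinset_card_of_nodup hl,
    List.length_cons]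

/-- The edge-weights along a self-avoiding path are independent of the presence of its edges and
of each other, so the expectation factorizes. -/
theorem IsSFP.lintegral_indicator_pathOpen (h : IsSFP α lam νW νL μ W G L) (θ : ℝ)
    {x : Lattice d} {l : List (Lattice d)} (hl : (x :: l).Nodup) (c : ℝ≥0∞) :
    ∫⁻ ω, (pathOpen G x l).indicator (fun ω =>
      ((pathEdges x l).map fun e => ENNReal.ofReal (Real.exp (-(θ * L e ω)))).prod * c) ω ∂μ =
      μ (pathOpen G x l) *
        (∫⁻ w, ENNReal.ofReal (Real.exp (-(θ * w))) ∂νL) ^ l.length * c := by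
  have hmeas : Measurable fun w : ℝ => ENNReal.ofReal (Real.exp (-(θ * w))) := by fun_prop
  have hmeasL : ∀ e, Measurable fun ω => ENNReal.ofReal (Real.exp (-(θ * L e ω))) :=
    fun e => hmeas.comp (h.measurable_L e)
  have hnd := nodup_pathEdges hl
  let A : Set ((Lattice d → ℝ) × (Sym2 (Lattice d) → Prop)) :=
    ⋂ e ∈ (pathEdges x l).toFinset, {q | q.2 e}
  have hA : MeasurableSet A := by
    refine Finset.measurableSet_biInter _ fun e _ => ?_
    exact measurableSet_setOfPred.2 ((measurable_pi_apply e).comp measurable_snd)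
  let ψ : (Sym2 (Lattice d) → ℝ) → ℝ≥0∞ := fun f =>
    ∏ e ∈ (pathEdges x l).toFinset, ENNReal.ofReal (Real.exp (-(θ * f e)))
  have hψ : Measurable ψ := Finset.measurable_prod _ fun e _ => hmeas.comp (measurable_pi_apply e)
  have hind := h.indep_WG_L.comp (measurable_const.indicator hA :
    Measurable (A.indicator (fun _ => (1 : ℝ≥0∞)))) hψ
  have hset : ∀ ω, A.indicator (fun _ => (1 : ℝ≥0∞))
      ((fun x => W x ω), (fun e => e ∈ (G ω).edgeSet)) = (pathOpen G x l).indicator 1 ω := by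
    intro ω
    have hiff : ((fun x => W x ω), (fun e => e ∈ (G ω).edgeSet)) ∈ A ↔ ω ∈ pathOpen G x l := by
      simp [A, pathOpen]
    by_cases hω : ω ∈ pathOpen G x l
    · rw [indicator_of_mem hω, indicator_of_mem (hiff.2 hω)]
      rfl
    · rw [indicator_of_notMem hω, indicator_of_notMem (fun h => hω (hiff.1 h))]
  have hopen := h.measurableSet_pathOpen x l
  have hψL : Measurable fun ω => ψ fun e => L e ω :=
    hψ.comp (measurable_pi_lambda _ h.measurable_L)
  have hfact : ∫⁻ ω, (pathOpen G x l).indicator 1 ω * ψ (fun e => L e ω) ∂μ =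
      (∫⁻ ω, (pathOpen G x l).indicator 1 ω ∂μ) * ∫⁻ ω, ψ (fun e => L e ω) ∂μ := by
    refine lintegral_mul_eq_lintegral_mul_lintegral_of_indepFun
      (measurable_one.indicator hopen) hψL ?_
    have hcomp : A.indicator (fun _ => (1 : ℝ≥0∞)) ∘
        (fun ω => ((fun x => W x ω), (fun e => e ∈ (G ω).edgeSet))) =
        (pathOpen G x l).indicator 1 := funext hset
    exact hcomp ▸ hind
  have hL : ∫⁻ ω, ψ (fun e => L e ω) ∂μ =
      (∫⁻ w, ENNReal.ofReal (Real.exp (-(θ * w))) ∂νL) ^ l.length := by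
    have hi : iIndepFun (fun e ω => ENNReal.ofReal (Real.exp (-(θ * L e ω)))) μ :=
      h.indep_L.comp (fun _ w => ENNReal.ofReal (Real.exp (-(θ * w)))) fun _ => hmeas
    have hlaw : ∀ e, ∫⁻ ω, ENNReal.ofReal (Real.exp (-(θ * L e ω))) ∂μ =
        ∫⁻ w, ENNReal.ofReal (Real.exp (-(θ * w))) ∂νL := fun e => by
      rw [← h.law_L e, lintegral_map hmeas (h.measurable_L e)]
    have hlen : (pathEdges x l).length = l.length := by
      clear * -
      induction l generalizing x with
      | nil => rfl
      | cons y l ih => simp [pathEdges, ih]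
    rw [lintegral_prod_eq_prod_lintegral_of_indepFun _ _ hi hmeasL,
      Finset.prod_congr rfl fun e _ => hlaw e, Finset.prod_const,
      List.toFinset_card_of_nodup hnd, hlen]
  rw [← hL, ← lintegral_indicator_one hopen, ← hfact, ← lintegral_mul_const c
    (by exact (measurable_one.indicator hopen).mul hψL)]
  refine lintegral_congr fun ω => ?_
  by_cases hω : ω ∈ pathOpen G x l
  · simp only [indicator_of_mem hω, Pi.one_apply, one_mul, ψ]
    rw [List.prod_toFinset _ hnd]
  · simp [indicator_of_notMem hω]

/-- The first-moment bound: if the one-step sum is less than `1`, the weighted path sum has finite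
expectation. -/
theorem IsSFP.lintegral_weightedPathSum_lt_top [IsProbabilityMeasure μ]
    (h : IsSFP α lam νW νL μ W G L)
    (hW : ∀ᵐ w ∂νW, 1 ≤ w) (hα : 0 ≤ α) (hlam : 0 < lam) {s : ℝ} (hs : 0 ≤ s) (hs1 : s ≤ 1)
    {θ ε : ℝ} (hM : ∫⁻ w, ENNReal.ofReal (w ^ s) ^ 2 ∂νW < ∞)
    (hρ : ENNReal.ofReal (max 1 (lam ^ s) * 2 ^ (α * s)) *
        (∫⁻ w, ENNReal.ofReal (w ^ s) ^ 2 ∂νW) *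
        (∑' z : Lattice d, ENNReal.ofReal ((1 + euclDist 0 z) ^ (-(α * s - ε)))) *
        (∫⁻ w, ENNReal.ofReal (Real.exp (-(θ * w))) ∂νL) < 1) (x : Lattice d) :
    ∫⁻ ω, weightedPathSum θ ε G L x ω ∂μ < ∞ := by
  set A := ENNReal.ofReal (max 1 (lam ^ s) * 2 ^ (α * s))
  set M := ∫⁻ w, ENNReal.ofReal (w ^ s) ^ 2 ∂νW
  set φ := ∫⁻ w, ENNReal.ofReal (Real.exp (-(θ * w))) ∂νL
  set S := ∑' z : Lattice d, ENNReal.ofReal ((1 + euclDist 0 z) ^ (-(α * s - ε))) with hS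
  set ρ := A * M * S * φ
  let f : Lattice d → Lattice d → ℝ≥0∞ := fun a b =>
    A * M * φ * ENNReal.ofReal ((1 + euclDist a b) ^ (-(α * s - ε)))
  have hf : ∀ a, ∑' b, f a b ≤ ρ := fun a => by
    rw [ENNReal.tsum_mul_left, tsum_one_add_euclDist_rpow, ← hS]
    exact le_of_eq (by ring)
  have hle : ∫⁻ ω, weightedPathSum θ ε G L x ω ∂μ ≤ M * ∑' l, pathProd f x l := by
    unfold weightedPathSum
    rw [lintegral_tsum fun l => 
      (h.measurable_weightedPathSum_term θ _ x l).aemeasurable, ← ENNReal.tsum_mul_left]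
    refine ENNReal.tsum_le_tsum fun l => ?_
    split_ifs with hl
    · rw [h.lintegral_indicator_pathOpen θ hl]
      refine le_trans (mul_le_mul_left (mul_le_mul_left
        (h.measure_pathOpen_le hW hα hlam hs hs1 hl) _) _) (le_of_eq ?_)
      have hstep : f = fun a b => M * φ * (A * ENNReal.ofReal ((1 + euclDist a b) ^ (-(α * s))) *
          ENNReal.ofReal ((1 + euclDist a b) ^ ε)) := by
        funext a b
        have h0 : 0 < 1 + euclDist a b := by linarith [euclDist_nonneg a b]
        simp only [f]
        rw [show -(α * s - ε) = -(α * s) + ε by ring, Real.rpow_add h0,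
          ENNReal.ofReal_mul (by positivity)]
        ring
      rw [hstep, pathProd_mul (fun _ _ => M * φ), pathProd_mul _
        (fun a b => ENNReal.ofReal ((1 + euclDist a b) ^ ε)), pathProd_const, mul_pow, pow_succ]
      ring
    · simp
  refine hle.trans_lt (ENNReal.mul_lt_top hM ((tsum_pathProd_le hf x).trans_lt ?_))
  rw [ENNReal.inv_lt_top]
  exact tsub_pos_of_lt hρ

end Expectation

/-! ### Balls -/

/-- Replacing the edge-weights by the constant `1` gives again a model of weighted scale-free
percolation; its `L`-distance is the graph distance. -/
theorem IsSFP.const_one {d : ℕ} {α lam : ℝ} {νW νL : Measure ℝ} {Ω : Type*} [MeasurableSpace Ω]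
    {μ : Measure Ω} [IsProbabilityMeasure μ] {W : Lattice d → Ω → ℝ}
    {G : Ω → SimpleGraph (Lattice d)} {L : Sym2 (Lattice d) → Ω → ℝ}
    (h : IsSFP α lam νW νL μ W G L) :
    IsSFP α lam νW (Measure.dirac 1) μ W G (fun _ _ => 1) where
  measurable_W := h.measurable_W
  measurable_G := h.measurable_G
  measurable_L _ := measurable_const
  law_W := h.law_W
  indep_W := h.indep_W
  cond_edges := h.cond_edges
  law_L _ := by simp [Measure.map_const]
  indep_L := by
    rw [iIndepFun_iff_measure_inter_preimage_eq_mul]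
    intro S sets _
    by_cases hS : ∀ i ∈ S, (1 : ℝ) ∈ sets i
    · rw [Finset.prod_eq_one fun i hi => by simp [hS i hi]]
      have : (⋂ i ∈ S, (fun _ : Ω => (1 : ℝ)) ⁻¹' sets i) = univ := by
        exact eq_univ_of_forall fun _ => mem_iInter₂.2 hS
      rw [this, measure_univ]
    · push Not at hS
      obtain ⟨i, hi, hi'⟩ := hS
      rw [Finset.prod_eq_zero hi (by simp [hi'])]
      refine measure_mono_null (biInter_subset_of_mem hi) ?_
      simp [hi']
  indep_WG_L := indepFun_const_right _ _

theorem lDist_one_le_of_edist_le {d : ℕ} {G : SimpleGraph (Lattice d)} {x y : Lattice d} {n : ℕ}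
    (h : G.edist x y ≤ n) : lDist G (fun _ => 1) x y ≤ ((n : ℝ) : EReal) := by
  obtain ⟨p, hp⟩ := SimpleGraph.exists_walk_of_edist_ne_top
    (ne_top_of_le_ne_top (ENat.natCast_ne_top n) h)
  rw [← hp, Nat.cast_le] at h
  refine iInf_le_of_le ⟨p.bypass, p.bypass_isPath⟩ (EReal.coe_le_coe_iff.2 ?_)
  simp only [List.map_const', List.sum_replicate, SimpleGraph.Walk.length_edges, nsmul_eq_mul,
    mul_one]
  exact_mod_cast p.length_bypass_le_length.trans h

/-- The inclusion for the `L`-balls. The rate comes from the exponents `θ` and `ε` of a weighted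
path sum `Y` of finite expectation, and the random time from the value of `log Y`. -/
theorem exists_lBall_subset_euclBall.{u} (d : ℕ) (hd : 0 < d) (α lam : ℝ) (hα : (d : ℝ) < α)
    (hlam : 0 < lam) (νW νL : Measure ℝ) [IsProbabilityMeasure νW] [IsProbabilityMeasure νL]
    (hW : ∀ᵐ w ∂νW, 1 ≤ w)
    (htail : (∃ τ : ℝ, PowerLawTail νW τ ∧ 2 < α * (τ - 1) / d) ∨ ThinnerThanPowerLaw νW)
    (hL : cdf νL 0 = 0) :
    ∃ C : ℝ, 0 < C ∧ ∀ (Ω : Type u) [MeasurableSpace Ω] (μ : Measure Ω) [IsProbabilityMeasure μ]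
      (W : Lattice d → Ω → ℝ) (G : Ω → SimpleGraph (Lattice d)) (L : Sym2 (Lattice d) → Ω → ℝ),
      IsSFP α lam νW νL μ W G L →
      ∃ t₀ : Lattice d → Ω → ℝ, (∀ x, Measurable (t₀ x)) ∧ ∀ x, ∀ᵐ ω ∂μ, ∀ t : ℝ, t₀ x ω ≤ t →
        lBall (G ω) (fun e => L e ω) x t ⊆ euclBall x (Real.exp (C * t)) := by
  have hα0 : 0 ≤ α := (Nat.cast_nonneg d).trans hα.le
  obtain ⟨s, hs, hs1, hds, hM⟩ := exists_moment_exponent hα hW htail hd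
  obtain ⟨β, hdβ, hβ⟩ := exists_between hds
  set ε := α * s - β with hε
  have hεpos : 0 < ε := by linarith
  set K := ENNReal.ofReal (max 1 (lam ^ s) * 2 ^ (α * s)) *
    (∫⁻ w, ENNReal.ofReal (w ^ s) ^ 2 ∂νW) *
    (∑' z : Lattice d, ENNReal.ofReal ((1 + euclDist 0 z) ^ (-(α * s - ε)))) with hK
  have hKtop : K ≠ ∞ := by
    refine ENNReal.mul_ne_top (ENNReal.mul_ne_top ENNReal.ofReal_ne_top hM.ne) ?_
    rw [show α * s - ε = β by rw [hε]; ring]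
    exact (summable_one_add_euclDist_rpow hdβ).tsum_ofReal_ne_top
  have hlim := ENNReal.Tendsto.const_mul (tendsto_lintegral_exp_neg_mul hL) (Or.inr hKtop)
  rw [mul_zero] at hlim
  obtain ⟨θ, hθ⟩ := (hlim.eventually (gt_mem_nhds zero_lt_one)).exists
  have hθ0 : (0 : ℝ) ≤ θ := Nat.cast_nonneg θ
  refine ⟨(θ + 1) / ε, by positivity, fun Ω _ μ _ W G L h => ?_⟩
  refine ⟨fun x ω => Real.log (weightedPathSum θ ε G L x ω).toReal + θ, fun x => ?_, fun x => ?_⟩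
  · exact (Real.measurable_log.comp (h.measurable_weightedPathSum θ ε x).ennreal_toReal).add_const _
  · have hfin := ae_lt_top (h.measurable_weightedPathSum θ ε x)
      (h.lintegral_weightedPathSum_lt_top hW hα0 hlam hs hs1 hM hθ x).ne
    filter_upwards [hfin] with ω hω t ht y hy
    have hy' := ofReal_rpow_le_of_lDist_le hθ0 hεpos.le hy
    have hone := one_le_weightedPathSum θ ε G L x ω
    set Y := weightedPathSum θ ε G L x ω
    have hY : Y = ENNReal.ofReal Y.toReal := (ENNReal.ofReal_toReal hω.ne).symm
    have hYpos : 0 < Y.toReal := ENNReal.toReal_pos (zero_lt_one.trans_le hone).ne' hω.ne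
    rw [hY, ← ENNReal.ofReal_mul (Real.exp_nonneg _),
      ENNReal.ofReal_le_ofReal_iff (by positivity)] at hy'
    have hr := euclDist_nonneg x y
    have hexp : Real.exp (θ * (t + 1)) * Y.toReal ≤ Real.exp ((θ + 1) / ε * t) ^ ε := by
      rw [← Real.exp_mul, ← Real.exp_log hYpos, ← Real.exp_add]
      refine Real.exp_le_exp.2 ?_
      rw [show (θ + 1) / ε * t * ε = (θ + 1) * t by field_simp]
      linarith
    have := (Real.rpow_le_rpow_iff (by positivity) (Real.exp_nonneg _) hεpos).1 (hy'.trans hexp)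
    simp only [euclBall, mem_ofPred_eq]
    linarith

end ScaleFreePercolation

theorem mainTheorem5 (d : ℕ) (hd : 0 < d) (α lam : ℝ) (hα : (d : ℝ) < α) (hlam : 0 < lam)
    (νW νL : Measure ℝ) [IsProbabilityMeasure νW] [IsProbabilityMeasure νL]
    (hW : ∀ᵐ w ∂νW, 1 ≤ w)
    (htail : (∃ τ : ℝ, ScaleFreePercolation.PowerLawTail νW τ ∧ 2 < α * (τ - 1) / d) ∨
      ScaleFreePercolation.ThinnerThanPowerLaw νW)
    (hL : cdf νL 0 = 0) :
    ∃ C C' : ℝ, 0 < C ∧ 0 < C' ∧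
      ∀ (Ω : Type*) [MeasurableSpace Ω] (μ : Measure Ω) [IsProbabilityMeasure μ]
        (W : ScaleFreePercolation.Lattice d → Ω → ℝ)
        (G : Ω → SimpleGraph (ScaleFreePercolation.Lattice d))
        (L : Sym2 (ScaleFreePercolation.Lattice d) → Ω → ℝ),
        ScaleFreePercolation.IsSFP α lam νW νL μ W G L →
        ∃ (n₀ : ScaleFreePercolation.Lattice d → Ω → ℕ)
          (t₀ : ScaleFreePercolation.Lattice d → Ω → ℝ),
          (∀ x, Measurable (n₀ x)) ∧ (∀ x, Measurable (t₀ x)) ∧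
          ∀ x, ∀ᵐ ω ∂μ,
            (∀ n : ℕ, n₀ x ω ≤ n →
              ScaleFreePercolation.graphBall (G ω) x n ⊆
                ScaleFreePercolation.euclBall x (Real.exp (C * n))) ∧
            (∀ t : ℝ, t₀ x ω ≤ t →
              ScaleFreePercolation.lBall (G ω) (fun e => L e ω) x t ⊆
                ScaleFreePercolation.euclBall x (Real.exp (C' * t))) := by
  have hd1 : cdf (Measure.dirac (1 : ℝ)) 0 = 0 := by
    rw [cdf_eq_real, measureReal_eq_zero_iff, Measure.dirac_apply' _ measurableSet_Iic]
    simp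
  obtain ⟨C, hC, hG⟩ := ScaleFreePercolation.exists_lBall_subset_euclBall d hd α lam hα hlam νW
    (Measure.dirac 1) hW htail hd1
  obtain ⟨C', hC', hL'⟩ := ScaleFreePercolation.exists_lBall_subset_euclBall d hd α lam hα hlam
    νW νL hW htail hL
  refine ⟨C, C', hC, hC', fun Ω _ μ _ W G L h => ?_⟩
  obtain ⟨s₀, hs₀, hs⟩ := hG Ω μ W G _ h.const_one
  obtain ⟨t₀, ht₀, ht⟩ := hL' Ω μ W G L h
  refine ⟨fun x ω => ⌈s₀ x ω⌉₊, t₀, fun x => Nat.measurable_ceil.comp (hs₀ x), ht₀, fun x => ?_⟩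
  filter_upwards [hs x, ht x] with ω h1 h2
  exact ⟨fun n hn y hy => h1 n (Nat.ceil_le.1 hn)
    (ScaleFreePercolation.lDist_one_le_of_edist_le hy), h2⟩
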